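/- Let $\mathbb K$ be an $L$-structure expanding a field $K$ of characteristic $0$, let $T$ be its complete theory and $F=\mathrm{dcl}(\emptyset)\subseteq K$. Assume that $\mathbb K$ is algebraically bounded over $F$: in every structure elementarily equivalent to $\mathbb K$, the model-theoretic algebraic closure of a set $A$ is the field-theoretic algebraic closure of $\mathrm{dcl}(\emptyset)\cup A$. Let $k\ge 2$, let $\eta_1,\dots,\eta_k$ be derivations on $F$, and let $T^{\bar\delta,nc}$ be the expansion of $T$, in the language $L^{\bar\delta}=L\cup\{\delta_1,\dots,\delta_k\}$, which says that each $\delta_i$ is a derivation extending $\eta_i$ (the $\delta_i$ are not required to commute). Let $T^{\bar\delta,nc}_g$ be a model completion of $T^{\bar\delta,nc}$: it extends $T^{\bar\delta,nc}$, every model of $T^{\bar\delta,nc}$ embeds in a model of it, and together with the diagram of any model of $T^{\bar\delta,nc}$ it is complete. A dimension function on a structure $M$ (in the sense of van den Dries) is a function $\dim$ from the sets $S\subseteq M^n$, $n\in\mathbb N$, that are definable with parameters to $\{-\infty\}\cup\mathbb N$ such that: $\dim S=-\infty$ iff $S=\emptyset$; $\dim\{a\}=0$ for all $a\in M$; $\dim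 M=1$; $\dim(S_1\cup S_2)=\max(\dim S_1,\dim S_2)$; $\dim$ is invariant under permutation of coordinates; and for every definable $S\subseteq M^{n+1}$ and $i\in\{0,1\}$, the set $S(i)$ of all $x\in M^n$ such that the fibre $S_x=\{y\in M:(x,y)\in S\}$ has dimension $i$ is definable, and $\dim\{(x,y)\in S: x\in S(i)\}=\dim S(i)+i$. **Lemma.** Let $(M,\bar\delta)$ be a model of $T^{\bar\delta,nc}_g$ and let $C_i=\{b\in M:\delta_i b=0\}$ for $1\le i\le k$. Then each $C_i$ is an $L^{\bar\delta}$-definable (without parameters) subfield of $M$, $M$ has infinite degree over each $C_i$, and $C_i+C_j=M$ for all $i\neq j$. Moreover, $(M,\bar\delta)$ has no dimension function. -/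

import Mathlib

universe u v w x

namespace GenericDer

open FirstOrder FirstOrder.Language

section ModelTheory

variable (L : FirstOrder.Language.{u, v}) {M : Type w} [L.Structure M]

/-- `a ∈ dcl(A)`: the singleton `{a}` is definable with parameters from `A`. -/
def dcl (A : Set M) : Set M := {a | A.Definable₁ L {a}}

/-- `a ∈ acl(A)`: `a` lies in a finite set that is definable with parameters from `A`. -/
def acl (A : Set M) : Set M := {a | ∃ s : Set M, s.Finite ∧ a ∈ s ∧ A.Definable₁ L s}

variable {L}

/-- `T'` is a model completion of `T`: it extends `T`, every model of `T` embeds in a model of `T'`,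
and, for every model `A` of `T`, the theory `T'` together with the diagram of `A` is complete (any
two models of `T'` that extend `A` satisfy the same formulas with parameters from `A`). -/
structure IsModelCompletion (T T' : L.Theory) : Prop where
  extends_theory : ∀ φ ∈ T, T' ⊨ᵇ φ
  exists_embedding : ∀ A : Theory.ModelType.{u, v, max u v} T,
    ∃ B : Theory.ModelType.{u, v, max u v} T', Nonempty (A ↪[L] B)
  diagram_complete : ∀ (A : Theory.ModelType.{u, v, max u v} T)
    (B₁ B₂ : Theory.ModelType.{u, v, max u v} T') (f₁ : A ↪[L] B₁) (f₂ : A ↪[L] B₂)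
    (φ : L.Formula A), φ.Realize f₁ ↔ φ.Realize f₂

variable (L M)

/-- `dim` is a dimension function on the `L`-structure `M` (van den Dries). "Definable" means
definable with parameters from `M`; only the values of `dim` on definable sets are constrained, and
`⊥` plays the role of `-∞`. -/
structure IsDimensionFunction (dim : ∀ n : ℕ, Set (Fin n → M) → WithBot ℕ) : Prop where
  /-- `dim S = -∞` iff `S` is empty. -/
  eq_bot_iff : ∀ (n : ℕ) (S : Set (Fin n → M)), (Set.univ : Set M).Definable L S →
    (dim n S = ⊥ ↔ S = ∅)
  /-- Points of `M` have dimension `0`. -/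
  singleton : ∀ a : M, dim 1 {![a]} = 0
  /-- The structure itself has dimension `1`. -/
  univ : dim 1 Set.univ = 1
  /-- The dimension of a union is the maximum of the dimensions. -/
  union : ∀ (n : ℕ) (S₁ S₂ : Set (Fin n → M)), (Set.univ : Set M).Definable L S₁ →
    (Set.univ : Set M).Definable L S₂ → dim n (S₁ ∪ S₂) = max (dim n S₁) (dim n S₂)
  /-- Invariance under permutations of the coordinates. -/
  perm : ∀ (n : ℕ) (S : Set (Fin n → M)) (σ : Equiv.Perm (Fin n)),
    (Set.univ : Set M).Definable L S → dim n ((fun z => z ∘ σ) '' S) = dim n S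
  /-- For definable `S ⊆ Mⁿ⁺¹` and `i ∈ {0, 1}`, the set `S(i)` of all `z ∈ Mⁿ` whose fibre
  `S_z ⊆ M` has dimension `i` is definable. -/
  definable_fiber : ∀ (n : ℕ) (S : Set (Fin (n + 1) → M)) (i : ℕ), i ≤ 1 →
    (Set.univ : Set M).Definable L S →
    (Set.univ : Set M).Definable L
      {z : Fin n → M | dim 1 {y : Fin 1 → M | Fin.snoc (α := fun _ => M) z (y 0) ∈ S} = i}
  /-- The part of `S` above `S(i)` has dimension `dim S(i) + i`. -/
  fiber : ∀ (n : ℕ) (S : Set (Fin (n + 1) → M)) (i : ℕ), i ≤ 1 →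
    (Set.univ : Set M).Definable L S →
    dim (n + 1) {p | p ∈ S ∧ dim 1
        {y : Fin 1 → M | Fin.snoc (α := fun _ => M) (Fin.init p) (y 0) ∈ S} = i} =
      dim n {z : Fin n → M | dim 1
        {y : Fin 1 → M | Fin.snoc (α := fun _ => M) z (y 0) ∈ S} = i} + i

end ModelTheory

section AlgebraicallyBounded

variable {L : FirstOrder.Language.{u, v}} (φ : FirstOrder.Language.ring →ᴸ L)

/-- The field `K` with its `L`-structure (`L` contains the language of rings through `φ`) is
algebraically bounded over `dcl(∅)`: in every structure `M` elementarily equivalent to it, the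
model-theoretic algebraic closure of a set `A` is the field-theoretic algebraic closure of
`dcl(∅) ∪ A`. -/
def AlgebraicallyBounded (K : Type w) [L.Structure K] : Prop :=
  ∀ (M : Type (max u v)) [Field M] [Ring.CompatibleRing M] [L.Structure M] [φ.IsExpansionOn M],
    M ⊨ L.completeTheory K → ∀ (A : Set M) (a : M),
      a ∈ acl L A ↔ IsAlgebraic (Subfield.closure (dcl L (∅ : Set M) ∪ A)) a

end AlgebraicallyBounded

/-- `η` restricts to a derivation from `F` to `F`, where `F` is the underlying set of a subring; the
values of `η` outside `F` play no role. -/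
structure IsDerivationOn {K : Type w} [CommRing K] (F : Set K) (η : K → K) : Prop where
  mapsTo : Set.MapsTo η F F
  map_add : ∀ a ∈ F, ∀ b ∈ F, η (a + b) = η a + η b
  leibniz : ∀ a ∈ F, ∀ b ∈ F, η (a * b) = a * η b + b * η a

/-- The function symbols `δ₁, …, δₖ`, all of them unary. -/
inductive DerFunc (k : ℕ) : ℕ → Type
  | der : Fin k → DerFunc k 1

/-- The language with function symbols `δ₁, …, δₖ` only. -/
def derLanguage (k : ℕ) : FirstOrder.Language.{0, 0} := ⟨DerFunc k, fun _ => Empty⟩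

/-- The expansion of `L` by the symbols `δ₁, …, δₖ`. -/
abbrev withDer (L : FirstOrder.Language.{u, v}) (k : ℕ) : FirstOrder.Language.{u, v} := L.sum (derLanguage k)

section DerTheory

variable {L : FirstOrder.Language.{u, v}} {k : ℕ}

/-- The symbol `δᵢ` in the expanded language. -/
def derSymb (L : FirstOrder.Language.{u, v}) {k : ℕ} (i : Fin k) : (withDer L k).Functions 1 :=
  Sum.inr (DerFunc.der i)

/-- The interpretation of `δᵢ` in a structure for the expanded language. -/
def derMap (L : FirstOrder.Language.{u, v}) {k : ℕ} {M : Type w} [(withDer L k).Structure M] (i : Fin k)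
    (a : M) : M :=
  Structure.funMap (derSymb L i) ![a]

/-- The inclusion of the language of rings in the expanded language. -/
def ringHom (φ : FirstOrder.Language.ring →ᴸ L) (k : ℕ) : FirstOrder.Language.ring →ᴸ withDer L k :=
  LHom.sumInl.comp φ

/-- The sentence `∀ x y, δᵢ (x + y) = δᵢ x + δᵢ y`. -/
def addAxiom (φ : FirstOrder.Language.ring →ᴸ L) (i : Fin k) : (withDer L k).Sentence :=
  let add := (ringHom φ k).onFunction Ring.addFunc
  let δ := derSymb L i
  ∀' ∀' (δ.apply₁ (add.apply₂ (&0) (&1)) =' add.apply₂ (δ.apply₁ (&0)) (δ.apply₁ (&1)))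

/-- The sentence `∀ x y, δᵢ (x * y) = x * δᵢ y + y * δᵢ x`. -/
def leibnizAxiom (φ : FirstOrder.Language.ring →ᴸ L) (i : Fin k) : (withDer L k).Sentence :=
  let add := (ringHom φ k).onFunction Ring.addFunc
  let mul := (ringHom φ k).onFunction Ring.mulFunc
  let δ := derSymb L i
  ∀' ∀' (δ.apply₁ (mul.apply₂ (&0) (&1)) ='
    add.apply₂ (mul.apply₂ (&0) (δ.apply₁ (&1))) (mul.apply₂ (&1) (δ.apply₁ (&0))))

/-- The sentence `∀ x y, χ(x, y) → δᵢ x = y`. -/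
def extAxiom (χ : L.BoundedFormula Empty 2) (i : Fin k) : (withDer L k).Sentence :=
  ∀' ∀' ((LHom.sumInl.onBoundedFormula χ) ⟹ ((derSymb L i).apply₁ (&0) =' &1))

/-- The expansion of the theory of `K` which says that `δ₁, …, δₖ` are derivations and that
each `δᵢ` extends the derivation `ηᵢ` of `F = dcl(∅)`; the latter is expressed by one axiom for each
`a ∈ F` and each `L`-formula `χ(x, y)` that defines `(a, ηᵢ a)` in `K`. The derivations are not
required to commute. -/
def derTheory (φ : FirstOrder.Language.ring →ᴸ L) (K : Type w) [L.Structure K] (η : Fin k → K → K) :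
    (withDer L k).Theory :=
  LHom.sumInl.onTheory (L.completeTheory K)
    ∪ Set.range (addAxiom φ) ∪ Set.range (leibnizAxiom φ)
    ∪ {θ | ∃ (i : Fin k) (χ : L.BoundedFormula Empty 2), ∃ a ∈ dcl L (∅ : Set K),
        (∀ x y : K, χ.Realize default ![x, y] ↔ x = a ∧ y = η i a) ∧ θ = extAxiom χ i}

end DerTheory

end GenericDer

/-!
The point is that in a model `M` of the model completion the map `b ↦ (δ₁ b, …, δₖ b)` is onto `Mᵏ`
(`exists_derMap_eq_of_isModelCompletion`). Given a model `A` of the theory of `k` derivations and a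
tuple `c` in `A`, take an elementary extension `E` of the `L`-structure `A` of larger cardinality,
and a `t` in `E` transcendental over `A`. In characteristic `0` a derivation of `A` extends to `E` with
any prescribed value at `t` (`exists_derivation_extension`), and since the derivations need not
commute they are extended one at a time, with `δᵢ t = cᵢ`. The result embeds in a model of the model
completion, and if `A` is such a model itself, completeness of its diagram yields a solution in `A`.

Surjectivity gives everything else. A solution of `δᵢ y = 0`, `δⱼ y = δⱼ a` decomposes `a` as
`y + (a - y)` in `Cᵢ + Cⱼ`. A solution of `δᵢ b = 1` is not algebraic over `Cᵢ`, so `M` has infinite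
degree over `Cᵢ`.

For a dimension function, consider the pairs `(y, z)` with `y ∈ C` and `z - b * y ∈ C'`. Fibred over
`y`, they have dimension `dim C + dim C'` (`dim_sub_mul_mem`). If `C = C'` is a subfield that omits
`b`, then `z` determines `y`, the dimension is at most `1`, and so `dim C = 0`
(`dim_subfield_eq_zero`). If `b = 1` and `C + C' = M`, where `dim C = dim C' = 0`, the set projects
onto `M` in `z` with fibres of dimension `0`, so that `1 = 0` (`false_of_dim_eq_zero`).
-/

open FirstOrder FirstOrder.Language

/-! ### Extension of derivations in characteristic zero -/

lemma Algebra.FormallySmooth.of_charZero (K L : Type*) [Field K] [Field L] [Algebra K L]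
    [CharZero K] : Algebra.FormallySmooth K L := by
  obtain ⟨s, hs⟩ := exists_isTranscendenceBasis K L
  have := hs.isAlgebraic_field
  exact .of_algebraicIndependent_of_isSeparable hs.1

/-- The infinitesimal lifting property for ring homomorphisms, with no algebra structure on the
target, so that the target may carry an unrelated one already. -/
lemma Algebra.FormallySmooth.exists_ringHom_lift {R A B C : Type*} [CommRing R] [CommRing A]
    [CommRing B] [CommRing C] [Algebra R A] [Algebra.FormallySmooth R A] (π : B →+* C)
    (hπ : Function.Surjective π) (hker : IsNilpotent (RingHom.ker π)) (g : R →+* B) (f : A →+* C)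
    (h : π.comp g = f.comp (algebraMap R A)) :
    ∃ F : A →+* B, π.comp F = f ∧ F.comp (algebraMap R A) = g := by
  let : Algebra R B := g.toAlgebra
  let : Algebra R C := (π.comp g).toAlgebra
  let π' : B →ₐ[R] C := { π with commutes' := fun _ => rfl }
  let f' : A →ₐ[R] C := { f with commutes' := fun r => (RingHom.congr_fun h r).symm }
  let F : A →ₐ[R] B := Algebra.FormallySmooth.liftOfSurjective f' π' hπ hker
  refine ⟨F, RingHom.ext fun x => ?_, RingHom.ext fun r => F.commutes r⟩
  exact Algebra.FormallySmooth.liftOfSurjective_apply f' π' hπ hker x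

lemma TrivSqZeroExt.isNilpotent_ker_fstHom (R : Type*) [CommRing R] :
    IsNilpotent (RingHom.ker (TrivSqZeroExt.fstHom R R R : TrivSqZeroExt R R →+* R)) := by
  suffices h : RingHom.ker (TrivSqZeroExt.fstHom R R R : TrivSqZeroExt R R →+* R) ^ 2 = ⊥ from
    ⟨2, h⟩
  rw [pow_two, eq_bot_iff, Ideal.mul_le]
  intro x hx y hy
  have hx' : x.fst = 0 := hx
  have hy' : y.fst = 0 := hy
  ext <;> simp [hx', hy']

/-- The ring homomorphism `x ↦ f x + ε d x` to the dual numbers given by a derivation `d` along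
`f`. -/
def TrivSqZeroExt.ringHomOfLeibniz {R S : Type*} [CommRing R] [CommRing S] (f : R →+* S)
    (d : R → S) (hadd : ∀ x y, d (x + y) = d x + d y)
    (hmul : ∀ x y, d (x * y) = f x * d y + f y * d x) : R →+* TrivSqZeroExt S S :=
  RingHom.mk'
    { toFun := fun x => TrivSqZeroExt.inl (f x) + TrivSqZeroExt.inr (d x)
      map_one' := by
        have h : d 1 = 0 := by simpa using hmul 1 1
        ext <;> simp [h]
      map_mul' := fun x y => by
        ext
        · simp
        · simp [hmul, mul_comm] }
    (fun x y => by ext <;> simp [hadd])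

open Polynomial in
/-- A derivation of a field `F` of characteristic `0` extends to any field `E` over `F`, with an
arbitrary value at a given transcendental `t`: the values on `F` and at `t` define a ring homomorphism `F[X] → E[ε]`, which
lifts to `E` because `E` is formally smooth over `F[X]`. -/
lemma exists_derivation_extension {F E : Type*} [Field F] [Field E] [CharZero F] [Algebra F E]
    {t : E} (ht : Transcendental F t) (c : E) (d : F → F) (hadd : ∀ x y, d (x + y) = d x + d y)
    (hmul : ∀ x y, d (x * y) = x * d y + y * d x) :
    ∃ D : E → E, (∀ x y, D (x + y) = D x + D y) ∧ (∀ x y, D (x * y) = x * D y + y * D x) ∧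
      (∀ a, D (algebraMap F E a) = algebraMap F E (d a)) ∧ D t = c := by
  let : Algebra F[X] E := (aeval t).toRingHom.toAlgebra
  have halg (p : F[X]) : algebraMap F[X] E p = aeval t p := rfl
  have hinj : Function.Injective (algebraMap F[X] E) := transcendental_iff_injective.1 ht
  have : FaithfulSMul F[X] E := (faithfulSMul_iff_algebraMap_injective _ _).2 hinj
  let : Algebra (FractionRing F[X]) E := FractionRing.liftAlgebra F[X] E
  have : Algebra.FormallySmooth F[X] (FractionRing F[X]) := .of_isLocalization (nonZeroDivisors _)
  have : CharZero (FractionRing F[X]) :=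
    charZero_of_injective_algebraMap (IsFractionRing.injective F[X] (FractionRing F[X]))
  have := Algebra.FormallySmooth.of_charZero (FractionRing F[X]) E
  have : Algebra.FormallySmooth F[X] E := .comp _ (FractionRing F[X]) _
  let g₀ : F →+* TrivSqZeroExt E E :=
    TrivSqZeroExt.ringHomOfLeibniz (algebraMap F E) (fun a => algebraMap F E (d a))
      (fun x y => by simp [hadd]) (fun x y => by simp [hmul])
  let g : F[X] →+* TrivSqZeroExt E E :=
    eval₂RingHom g₀ (TrivSqZeroExt.inl t + TrivSqZeroExt.inr c)
  let π : TrivSqZeroExt E E →+* E := TrivSqZeroExt.fstHom E E E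
  have hg₀ (a : F) : g₀ a = TrivSqZeroExt.inl (algebraMap F E a) +
    TrivSqZeroExt.inr (algebraMap F E (d a)) := rfl
  have hπ (x : TrivSqZeroExt E E) : π x = x.fst := rfl
  obtain ⟨H, h₁, h₂⟩ := Algebra.FormallySmooth.exists_ringHom_lift (R := F[X]) (A := E) π
    (fun x => ⟨TrivSqZeroExt.inl x, rfl⟩) (TrivSqZeroExt.isNilpotent_ker_fstHom E) g
    (RingHom.id E) (by
      ext a
      · simp [g, hg₀, hπ, halg]
      · simp [g, hπ, halg])
  have hfst (x : E) : (H x).fst = x := RingHom.congr_fun h₁ x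
  refine ⟨fun x => (H x).snd, fun x y => by simp, fun x y => by simp [hfst, mul_comm],
    fun a => ?_, ?_⟩
  · have := RingHom.congr_fun h₂ (C a)
    simp only [RingHom.comp_apply, halg, aeval_C] at this
    simp [this, g, hg₀, ← Algebra.algebraMap_eq_smul_one]
  · have := RingHom.congr_fun h₂ X
    simp only [RingHom.comp_apply, halg, aeval_X] at this
    simp [this, g]

/-! ### Definable functions in expansions of rings -/

namespace Set

lemma Definable₁.preimage_definableFun {L : FirstOrder.Language} {M : Type*} [L.Structure M]
    {A : Set M} {α : Type*} {C : Set M} (hC : A.Definable₁ L C) {f : (α → M) → M}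
    (hf : A.DefinableFun L f) : A.Definable L {v | f v ∈ C} := by
  have h := Definable.preimage_map (F := fun v (_ : Fin 1) => f v) (fun _ => hf) hC
  exact h

lemma DefinableFun.add {L : FirstOrder.Language} (ψ : FirstOrder.Language.ring →ᴸ L) {M : Type*}
    [Ring M] [Ring.CompatibleRing M] [L.Structure M] [ψ.IsExpansionOn M] {A : Set M} {α : Type*}
    {f g : (α → M) → M} (hf : A.DefinableFun L f) (hg : A.DefinableFun L g) :
    A.DefinableFun L fun v => f v + g v := by
  have h := DefinableFun.comp (g := fun v => ![f v, g v])
    (by simp [DefinableMap, Fin.forall_fin_two, hf, hg])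
    ((DefinableFun.fun_symbol (ψ.onFunction Ring.addFunc)).of_empty (A := A))
  simpa using h

lemma DefinableFun.mul {L : FirstOrder.Language} (ψ : FirstOrder.Language.ring →ᴸ L) {M : Type*}
    [Ring M] [Ring.CompatibleRing M] [L.Structure M] [ψ.IsExpansionOn M] {A : Set M} {α : Type*}
    {f g : (α → M) → M} (hf : A.DefinableFun L f) (hg : A.DefinableFun L g) :
    A.DefinableFun L fun v => f v * g v := by
  have h := DefinableFun.comp (g := fun v => ![f v, g v])
    (by simp [DefinableMap, Fin.forall_fin_two, hf, hg])
    ((DefinableFun.fun_symbol (ψ.onFunction Ring.mulFunc)).of_empty (A := A))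
  simpa using h

lemma DefinableFun.neg {L : FirstOrder.Language} (ψ : FirstOrder.Language.ring →ᴸ L) {M : Type*}
    [Ring M] [Ring.CompatibleRing M] [L.Structure M] [ψ.IsExpansionOn M] {A : Set M} {α : Type*}
    {f : (α → M) → M} (hf : A.DefinableFun L f) : A.DefinableFun L fun v => -f v := by
  have h := DefinableFun.comp (g := fun v => ![f v]) (by simp [DefinableMap, hf])
    ((DefinableFun.fun_symbol (ψ.onFunction Ring.negFunc)).of_empty (A := A))
  simpa using h

lemma DefinableFun.sub {L : FirstOrder.Language} (ψ : FirstOrder.Language.ring →ᴸ L) {M : Type*}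
    [Ring M] [Ring.CompatibleRing M] [L.Structure M] [ψ.IsExpansionOn M] {A : Set M} {α : Type*}
    {f g : (α → M) → M} (hf : A.DefinableFun L f) (hg : A.DefinableFun L g) :
    A.DefinableFun L fun v => f v - g v := by
  simpa only [sub_eq_add_neg] using hf.add ψ (hg.neg ψ)

lemma Definable.rel_swap {L : FirstOrder.Language} {M : Type*} [L.Structure M] {A : Set M}
    (P : M → M → Prop) (hP : A.Definable L {p : Fin 2 → M | P (p 0) (p 1)}) :
    A.Definable L {p : Fin 2 → M | P (p 1) (p 0)} := by
  have h := hP.preimage_comp (Equiv.swap (0 : Fin 2) 1)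
  simpa [preimage] using! h

lemma Definable.rel_domain {L : FirstOrder.Language} {M : Type*} [L.Structure M] {A : Set M}
    (P : M → M → Prop) (hP : A.Definable L {p : Fin 2 → M | P (p 0) (p 1)}) :
    A.Definable L {x : Fin 1 → M | ∃ y, P (x 0) y} := by
  have h := (hP.preimage_comp ![(Sum.inl 0 : Fin 1 ⊕ Fin 1), Sum.inr 0]).exists_of_finite
  convert h using 1
  ext x
  exact ⟨fun ⟨y, hy⟩ => ⟨fun _ => y, hy⟩, fun ⟨y, hy⟩ => ⟨y 0, hy⟩⟩

end Set

/-! ### Dimension functions on expansions of fields -/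

namespace GenericDer.IsDimensionFunction

open Set

section Basic

variable {L : FirstOrder.Language} {M : Type*} [L.Structure M]
  {dim : ∀ n : ℕ, Set (Fin n → M) → WithBot ℕ}

lemma mono (hd : IsDimensionFunction L M dim) {n : ℕ} {S T : Set (Fin n → M)}
    (hS : (Set.univ : Set M).Definable L S) (hT : (Set.univ : Set M).Definable L T) (h : S ⊆ T) :
    dim n S ≤ dim n T := by
  rw [← union_eq_self_of_subset_left h, hd.union n S T hS hT]
  exact le_max_left _ _

lemma eq_point (hd : IsDimensionFunction L M dim) (a : M) :
    dim 1 {y : Fin 1 → M | y 0 = a} = 0 := by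
  rw [← hd.singleton a]
  congr 1
  ext y
  simp [funext_iff, Fin.forall_fin_one]

lemma le_one (hd : IsDimensionFunction L M dim) {S : Set (Fin 1 → M)}
    (hS : (Set.univ : Set M).Definable L S) : dim 1 S ≤ 1 :=
  (hd.mono hS definable_univ (subset_univ S)).trans_eq hd.univ

lemma exists_eq_natCast (hd : IsDimensionFunction L M dim) {S : Set (Fin 1 → M)}
    (hS : (Set.univ : Set M).Definable L S) (hne : S.Nonempty) : ∃ i : ℕ, i ≤ 1 ∧ dim 1 S = i := by
  have h := hd.le_one hS
  have h' : dim 1 S ≠ ⊥ := fun h => hne.ne_empty ((hd.eq_bot_iff 1 S hS).1 h)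
  obtain ⟨i, hi⟩ := WithBot.ne_bot_iff_exists.1 h'
  rw [← hi] at h ⊢
  exact ⟨i, WithBot.coe_le_coe.1 h, rfl⟩

/-- A binary relation all of whose fibres over its domain `C` have the same dimension `i` has
dimension `dim C + i`. -/
lemma dim_rel (hd : IsDimensionFunction L M dim) {P : M → M → Prop}
    (hP : (Set.univ : Set M).Definable L {p : Fin 2 → M | P (p 0) (p 1)}) {C : Set M} {i : ℕ}
    (hi : i ≤ 1) (hC : ∀ x y, P x y → x ∈ C)
    (hfib : ∀ x ∈ C, dim 1 {y : Fin 1 → M | P x (y 0)} = i) :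
    dim 2 {p : Fin 2 → M | P (p 0) (p 1)} = dim 1 {x : Fin 1 → M | x 0 ∈ C} + i := by
  have h := hd.fiber 1 _ i hi hP
  have hfibre (z : Fin 1 → M) :
      {y : Fin 1 → M | Fin.snoc (α := fun _ => M) z (y 0) ∈ {p : Fin 2 → M | P (p 0) (p 1)}} =
        {y : Fin 1 → M | P (z 0) (y 0)} := by
    ext y
    rfl
  simp only [hfibre] at h
  convert h using 2
  · ext p
    exact ⟨fun hp => ⟨hp, hfib _ (hC _ _ hp)⟩, fun hp => hp.1⟩
  · congr 1
    ext z
    refine ⟨fun hz => hfib _ hz, fun hz => ?_⟩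
    by_contra hzC
    have hempty : {y : Fin 1 → M | P (z 0) (y 0)} = ∅ :=
      eq_empty_of_forall_notMem fun y hy => hzC (hC _ _ hy)
    have hz' : dim 1 {y : Fin 1 → M | P (z 0) (y 0)} = i := hz
    rw [hempty, (hd.eq_bot_iff 1 ∅ definable_empty).2 rfl] at hz'
    exact WithBot.bot_ne_coe hz'

lemma dim_rel_swap (hd : IsDimensionFunction L M dim) {P : M → M → Prop}
    (hP : (Set.univ : Set M).Definable L {p : Fin 2 → M | P (p 0) (p 1)}) :
    dim 2 {p : Fin 2 → M | P (p 1) (p 0)} = dim 2 {p : Fin 2 → M | P (p 0) (p 1)} := by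
  rw [← hd.perm 2 _ (Equiv.swap 0 1) hP]
  congr 1
  ext p
  constructor
  · intro hp
    refine ⟨p ∘ Equiv.swap 0 1, by simpa using! hp, ?_⟩
    ext j
    simp
  · rintro ⟨q, hq, rfl⟩
    simpa using! hq

end Basic

section Field

/-- The graph of the translation by `b` restricted to `C` has one-point fibres over both of its
projections. -/
lemma dim_translate {L : FirstOrder.Language} (ψ : FirstOrder.Language.ring →ᴸ L) {M : Type*}
    [Field M] [Ring.CompatibleRing M] [L.Structure M] [ψ.IsExpansionOn M]
    {dim : ∀ n : ℕ, Set (Fin n → M) → WithBot ℕ} (hd : IsDimensionFunction L M dim) {C : Set M}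
    (hC : (Set.univ : Set M).Definable₁ L C) (b : M) :
    dim 1 {z : Fin 1 → M | z 0 - b ∈ C} = dim 1 {z : Fin 1 → M | z 0 ∈ C} := by
  have hb {n : ℕ} : (Set.univ : Set M).DefinableFun L fun _ : Fin n → M => b :=
    L.definableFun_const _ (mem_univ b)
  have hP : (Set.univ : Set M).Definable L {p : Fin 2 → M | p 0 ∈ C ∧ p 1 = p 0 + b} :=
    (hC.preimage_definableFun (f := fun p : Fin 2 → M => p 0) (by fun_prop)).inter
      (DefinableFun.ofPred_eq (by fun_prop) (DefinableFun.add ψ (by fun_prop) hb))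
  have h₁ := hd.dim_rel (P := fun x z => x ∈ C ∧ z = x + b) (C := C) (i := 0) hP zero_le_one
    (fun x y h => h.1) (fun x hx => by simpa [hx] using hd.eq_point (x + b))
  have h₂ := hd.dim_rel (P := fun z x => x ∈ C ∧ z = x + b) (C := {z | z - b ∈ C}) (i := 0)
    (Definable.rel_swap (fun x z => x ∈ C ∧ z = x + b) hP) zero_le_one
    (by rintro z x ⟨hx, rfl⟩; simpa using hx) (fun z hz => by
      rw [Nat.cast_zero, ← hd.eq_point (z - b)]
      congr 1
      ext y
      refine ⟨fun h => eq_sub_of_add_eq h.2.symm, fun h => ?_⟩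
      have h : y 0 = z - b := h
      exact ⟨h ▸ hz, by rw [h, sub_add_cancel]⟩)
  rw [hd.dim_rel_swap (P := fun x z => x ∈ C ∧ z = x + b) hP, h₁] at h₂
  simpa using h₂.symm

lemma definable_sub_mul_mem {L : FirstOrder.Language} (ψ : FirstOrder.Language.ring →ᴸ L)
    {M : Type*} [Field M] [Ring.CompatibleRing M] [L.Structure M] [ψ.IsExpansionOn M]
    {C C' : Set M} (hC : (Set.univ : Set M).Definable₁ L C)
    (hC' : (Set.univ : Set M).Definable₁ L C') (b : M) :
    (Set.univ : Set M).Definable L {p : Fin 2 → M | p 0 ∈ C ∧ p 1 - b * p 0 ∈ C'} :=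
  (hC.preimage_definableFun (f := fun p : Fin 2 → M => p 0) (by fun_prop)).inter
    (hC'.preimage_definableFun (DefinableFun.sub ψ (by fun_prop)
      (DefinableFun.mul ψ (L.definableFun_const _ (mem_univ b)) (by fun_prop))))

/-- The set of pairs `(y, z)` with `y ∈ C` and `z ∈ b * y + C'` fibres over `C` in translates of
`C'`, so that it behaves as `C × C'`. -/
lemma dim_sub_mul_mem {L : FirstOrder.Language} (ψ : FirstOrder.Language.ring →ᴸ L) {M : Type*}
    [Field M] [Ring.CompatibleRing M] [L.Structure M] [ψ.IsExpansionOn M]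
    {dim : ∀ n : ℕ, Set (Fin n → M) → WithBot ℕ} (hd : IsDimensionFunction L M dim) {C C' : Set M}
    (hC : (Set.univ : Set M).Definable₁ L C) (hC' : (Set.univ : Set M).Definable₁ L C')
    (hne : C'.Nonempty) (b : M) :
    dim 2 {p : Fin 2 → M | p 0 ∈ C ∧ p 1 - b * p 0 ∈ C'} =
      dim 1 {x : Fin 1 → M | x 0 ∈ C} + dim 1 {x : Fin 1 → M | x 0 ∈ C'} := by
  obtain ⟨c, hc⟩ := hne
  obtain ⟨i, hi, hdim⟩ := hd.exists_eq_natCast hC' ⟨fun _ => c, hc⟩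
  rw [hdim]
  refine hd.dim_rel (P := fun y z => y ∈ C ∧ z - b * y ∈ C') (definable_sub_mul_mem ψ hC hC' b) hi
    (fun y z h => h.1) (fun y hy => ?_)
  simpa [hy, ← hdim] using hd.dim_translate ψ hC' (b * y)

/-- If `b ∉ C`, then `(y, c) ↦ b * y + c` is injective on `C × C`, so that `2 * dim C ≤ 1`. -/
lemma dim_subfield_eq_zero {L : FirstOrder.Language} (ψ : FirstOrder.Language.ring →ᴸ L) {M : Type*}
    [Field M] [Ring.CompatibleRing M] [L.Structure M] [ψ.IsExpansionOn M]
    {dim : ∀ n : ℕ, Set (Fin n → M) → WithBot ℕ} (hd : IsDimensionFunction L M dim) {C : Subfield M}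
    (hC : (Set.univ : Set M).Definable₁ L (C : Set M)) {b : M} (hb : b ∉ C) :
    dim 1 {x : Fin 1 → M | x 0 ∈ C} = 0 := by
  obtain ⟨i, hi, hdim⟩ := hd.exists_eq_natCast hC ⟨fun _ => 0, C.zero_mem⟩
  have hP := definable_sub_mul_mem ψ hC hC b
  have h₁ := hd.dim_sub_mul_mem ψ hC hC ⟨0, C.zero_mem⟩ b
  rw [← hd.dim_rel_swap (P := fun y z => y ∈ (C : Set M) ∧ z - b * y ∈ (C : Set M)) hP,
    hd.dim_rel (P := fun z y => y ∈ (C : Set M) ∧ z - b * y ∈ (C : Set M))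
    (C := {z | ∃ y, y ∈ (C : Set M) ∧ z - b * y ∈ (C : Set M)}) (i := 0)
    (hP.rel_swap fun y z => y ∈ (C : Set M) ∧ z - b * y ∈ (C : Set M)) zero_le_one
    (fun z y h => ⟨y, h⟩) ?_] at h₁
  -- The left-hand side of `h₁` is now the dimension of a subset of the line.
  · have hdom := Definable.rel_domain (fun z y => y ∈ (C : Set M) ∧ z - b * y ∈ (C : Set M))
      (hP.rel_swap fun y z => y ∈ (C : Set M) ∧ z - b * y ∈ (C : Set M))
    have hle := hd.le_one hdom
    have hii : (i : WithBot ℕ) + i ≤ 1 := by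
      rw [← hdim, ← h₁]
      simpa using hle
    have hii : i + i ≤ 1 := by exact_mod_cast hii
    obtain rfl : i = 0 := by omega
    exact hdim
  · rintro z ⟨y, hy, hz⟩
    rw [Nat.cast_zero, ← hd.eq_point y]
    congr 1
    ext w
    refine ⟨fun ⟨hw, hzw⟩ => ?_, fun hw => ?_⟩
    -- Two solutions `y`, `w` for the same `z` would give `b` as a quotient of elements of `C`.
    · by_contra hne
      have hne : y - w 0 ≠ 0 := fun h => hne (sub_eq_zero.1 h).symm
      refine hb ?_
      have := C.div_mem (C.sub_mem hzw hz) (C.sub_mem hy hw)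
      rwa [show z - b * w 0 - (z - b * y) = b * (y - w 0) by ring,
        mul_div_cancel_right₀ _ hne] at this
    · have hw : w 0 = y := hw
      change w 0 ∈ (C : Set M) ∧ z - b * w 0 ∈ (C : Set M)
      rw [hw]
      exact ⟨hy, hz⟩

/-- If `C` and `C'` have dimension `0`, so has the set of pairs `(y, z)` with `y ∈ C` and
`z ∈ y + C'`; when `C + C'` is everything, it projects onto the whole line in `z` with fibres of
dimension `0`. -/
lemma false_of_dim_eq_zero {L : FirstOrder.Language} (ψ : FirstOrder.Language.ring →ᴸ L) {M : Type*}
    [Field M] [Ring.CompatibleRing M] [L.Structure M] [ψ.IsExpansionOn M]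
    {dim : ∀ n : ℕ, Set (Fin n → M) → WithBot ℕ} (hd : IsDimensionFunction L M dim) {C C' : Set M}
    (hC : (Set.univ : Set M).Definable₁ L C) (hC' : (Set.univ : Set M).Definable₁ L C')
    (h : dim 1 {x : Fin 1 → M | x 0 ∈ C} = 0) (h' : dim 1 {x : Fin 1 → M | x 0 ∈ C'} = 0)
    (hsum : ∀ a : M, ∃ b ∈ C, ∃ c ∈ C', a = b + c) : False := by
  have hne : C'.Nonempty := by
    obtain ⟨_, _, c, hc, _⟩ := hsum 0
    exact ⟨c, hc⟩
  have hP := definable_sub_mul_mem ψ hC hC' 1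
  have h₁ := hd.dim_sub_mul_mem ψ hC hC' hne 1
  rw [← hd.dim_rel_swap (P := fun y z => y ∈ C ∧ z - 1 * y ∈ C') hP,
    hd.dim_rel (P := fun z y => y ∈ C ∧ z - 1 * y ∈ C') (C := Set.univ) (i := 0)
    (hP.rel_swap fun y z => y ∈ C ∧ z - 1 * y ∈ C') zero_le_one
    (fun z y h => mem_univ z) ?_, h, h'] at h₁
  · simp [hd.univ] at h₁
  · intro z _
    have hfib : (Set.univ : Set M).Definable L {y : Fin 1 → M | y 0 ∈ C ∧ z - 1 * y 0 ∈ C'} :=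
      hC.inter (hC'.preimage_definableFun (DefinableFun.sub ψ (L.definableFun_const _ (mem_univ z))
        (DefinableFun.mul ψ (L.definableFun_const _ (mem_univ 1)) (by fun_prop))))
    obtain ⟨y, hy, c, hc, rfl⟩ := hsum z
    obtain ⟨i, -, hi⟩ := hd.exists_eq_natCast hfib ⟨fun _ => y, hy, by simpa using hc⟩
    have hle := hd.mono hfib hC inter_subset_left
    rw [h, hi] at hle
    rw [hi]
    have : i ≤ 0 := by exact_mod_cast hle
    simp [Nat.le_zero.1 this]

end Field

end GenericDer.IsDimensionFunction

namespace GenericDer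

/-! ### Models of the complete theory are fields of characteristic zero -/

section Field

variable {L : FirstOrder.Language.{u, v}} {φ : FirstOrder.Language.ring →ᴸ L}

lemma model_fieldOfChar_zero_of_completeTheory {K : Type w} [Field K] [CharZero K]
    [Ring.CompatibleRing K] [L.Structure K] [φ.IsExpansionOn K] {N : Type x}
    [FirstOrder.Language.ring.Structure N] [L.Structure N] [φ.IsExpansionOn N]
    (hN : N ⊨ L.completeTheory K) : N ⊨ Theory.fieldOfChar 0 := by
  have : CharP K 0 := CharP.ofCharZero K
  rw [← φ.onTheory_model]
  refine Theory.Model.mono hN fun σ hσ => ?_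
  have hK : K ⊨ φ.onTheory (Theory.fieldOfChar 0) := (φ.onTheory_model _).2 inferInstance
  exact hK.realize_of_mem σ hσ

lemma charZero_of_completeTheory {K : Type w} [Field K] [CharZero K]
    [Ring.CompatibleRing K] [L.Structure K] [φ.IsExpansionOn K] {N : Type x} [Field N]
    [Ring.CompatibleRing N] [L.Structure N] [φ.IsExpansionOn N]
    (hN : N ⊨ L.completeTheory K) : CharZero N := by
  have := model_fieldOfChar_zero_of_completeTheory (φ := φ) hN
  have := Field.charP_of_model_fieldOfChar 0 N
  exact CharP.charP_to_charZero N

lemma exists_field_of_completeTheory {K : Type w} [Field K] [CharZero K]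
    [Ring.CompatibleRing K] [L.Structure K] [φ.IsExpansionOn K] {N : Type x} [L.Structure N]
    (hN : N ⊨ L.completeTheory K) :
    ∃ (_ : Field N) (_ : Ring.CompatibleRing N), φ.IsExpansionOn N ∧ CharZero N := by
  let : FirstOrder.Language.ring.Structure N := φ.reduct N
  have h := model_fieldOfChar_zero_of_completeTheory (φ := φ) hN
  have : N ⊨ Theory.field := h.mono Set.subset_union_left
  let : Field N := Field.fieldOfModelField N
  let : Ring.CompatibleRing N := Field.compatibleRingOfModelField N
  have hφ : φ.IsExpansionOn N := ⟨fun _ _ => rfl, fun _ _ => rfl⟩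
  exact ⟨inferInstance, inferInstance, hφ, charZero_of_completeTheory (φ := φ) hN⟩

end Field

/-! ### The axioms on the derivations -/

section DerTheory

variable {L : FirstOrder.Language.{u, v}} {φ : FirstOrder.Language.ring →ᴸ L} {k : ℕ}

lemma realize_addAxiom {N : Type x} [Field N] [Ring.CompatibleRing N]
    [(withDer L k).Structure N] [(ringHom φ k).IsExpansionOn N] (i : Fin k) :
    N ⊨ addAxiom φ i ↔ ∀ a b : N, derMap L i (a + b) = derMap L i a + derMap L i b := by
  simp [addAxiom, Sentence.Realize, Formula.Realize, derMap, Fin.snoc]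

lemma realize_leibnizAxiom {N : Type x} [Field N] [Ring.CompatibleRing N]
    [(withDer L k).Structure N] [(ringHom φ k).IsExpansionOn N] (i : Fin k) :
    N ⊨ leibnizAxiom φ i ↔
      ∀ a b : N, derMap L i (a * b) = a * derMap L i b + b * derMap L i a := by
  simp [leibnizAxiom, Sentence.Realize, Formula.Realize, derMap, Fin.snoc]

lemma realize_extAxiom {N : Type x} [L.Structure N] [(withDer L k).Structure N]
    [(LHom.sumInl : L →ᴸ withDer L k).IsExpansionOn N] (i : Fin k)
    (χ : L.BoundedFormula Empty 2) :
    N ⊨ extAxiom χ i ↔ ∀ a b : N, χ.Realize default ![a, b] → derMap L i a = b := by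
  have (a b : N) : (Fin.snoc (Fin.snoc default a) b : Fin 2 → N) = ![a, b] := by
    ext j; fin_cases j <;> rfl
  simp [extAxiom, Sentence.Realize, Formula.Realize, derMap, this]

/-- The formula `∃ y, ⋀ᵢ δᵢ y = vᵢ` in the free variables `v₁, …, vₖ`. -/
noncomputable def commonPreimage (L : FirstOrder.Language.{u, v}) (k : ℕ) :
    (withDer L k).Formula (Fin k) :=
  ∃' BoundedFormula.iInf fun i : Fin k =>
    (derSymb L i).apply₁ (&0) =' Term.var (Sum.inl i)

lemma realize_commonPreimage {N : Type x} [(withDer L k).Structure N] (c : Fin k → N) :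
    (commonPreimage L k).Realize c ↔ ∃ b, ∀ i, derMap L i b = c i := by
  simp [commonPreimage, Formula.Realize, derMap, Fin.snoc]

end DerTheory
/-! ### Common preimages under the derivations -/

section Extension

variable {L : FirstOrder.Language.{u, v}} {φ : FirstOrder.Language.ring →ᴸ L}

lemma map_ring_of_elementaryEmbedding {A : Type w} {E : Type x} [Field A] [Ring.CompatibleRing A]
    [L.Structure A] [φ.IsExpansionOn A] [Field E] [Ring.CompatibleRing E] [L.Structure E]
    [φ.IsExpansionOn E] (f : A ↪ₑ[L] E) : ∃ g : A →+* E, ∀ a, g a = f a := by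
  have hadd (a b : A) : f (a + b) = f a + f b := by
    simpa using f.map_fun (φ.onFunction Ring.addFunc) ![a, b]
  have hmul (a b : A) : f (a * b) = f a * f b := by
    simpa using f.map_fun (φ.onFunction Ring.mulFunc) ![a, b]
  have hone : f 1 = 1 := by
    simpa using f.map_fun (φ.onFunction Ring.oneFunc) ![]
  exact ⟨RingHom.mk' { toFun := f, map_one' := hone, map_mul' := hmul } hadd, fun _ => rfl⟩

open Cardinal in
lemma exists_elementaryEmbedding_mk_lt (L : FirstOrder.Language.{u, v}) (A : Type max u v)
    [L.Structure A] [Infinite A] :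
    ∃ (E : Type max u v) (_ : L.Structure E), Nonempty (A ↪ₑ[L] E) ∧ #A < #E := by
  obtain ⟨E, hE, hcard⟩ := exists_elementaryEmbedding_card_eq_of_ge L A
    (max (Order.succ #A) L.card) (by simp)
    (by simpa using (Order.le_succ #A).trans (le_max_left _ L.card))
  exact ⟨E, inferInstance, hE, hcard ▸ (Order.lt_succ #A).trans_le (le_max_left _ _)⟩

open Cardinal in
lemma exists_transcendental_of_mk_lt {A E : Type u} [Field A] [Field E] [Algebra A E] [Infinite A]
    (h : #A < #E) : ∃ t : E, Transcendental A t := by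
  by_contra! hE
  have : Algebra.IsAlgebraic A E := ⟨fun t => not_not.1 (hE t)⟩
  have hle := Algebra.IsAlgebraic.cardinalMk_le_max A E
  rw [max_eq_left (aleph0_le_mk A)] at hle
  exact hle.not_gt h

/-- That exactly one pair satisfies `χ` is a single sentence, so it passes between models of a
complete theory. -/
lemma realize_iExsUnique_toFormula {N : Type x} [L.Structure N] (χ : L.BoundedFormula Empty 2) :
    N ⊨ (χ.toFormula.iExsUnique (Fin 2) : L.Sentence) ↔
      ∃! p : Fin 2 → N, χ.Realize default p := by
  rw [Sentence.Realize, Formula.realize_iExsUnique]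
  simp [BoundedFormula.realize_toFormula, Subsingleton.elim _ (default : Empty → N)]

/-- Interpretation of the symbols `δᵢ` by given functions `D i`. -/
@[reducible]
def derStructure {k : ℕ} {E : Type x} (D : Fin k → E → E) : (derLanguage k).Structure E where
  funMap := fun {_} g => match g with
    | .der i => fun y => D i (y 0)
  RelMap := fun r => nomatch r

/-- Every tuple `c` of a model of `derTheory φ K η` is `(δ₁ t, …, δₖ t)` for some `t` in an
extension: `t` is a transcendental in an elementary extension for `L`, to which the derivations are
extended independently of each other. No commutation is required, so nothing obstructs this. -/
lemma exists_extension_commonPreimage {K : Type w} [Field K] [CharZero K] [Ring.CompatibleRing K]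
    [L.Structure K] [φ.IsExpansionOn K] {k : ℕ} {η : Fin k → K → K}
    (A : Theory.ModelType.{u, v, max u v} (derTheory φ K η)) (c : Fin k → A) :
    ∃ (B : Theory.ModelType.{u, v, max u v} (derTheory φ K η)) (f : A ↪[withDer L k] B) (b : B),
      ∀ i, derMap L i b = f (c i) := by
  have hA : A ⊨ derTheory φ K η := A.is_model
  simp only [derTheory, Theory.model_union_iff, LHom.onTheory_model] at hA
  obtain ⟨⟨⟨hAK, hAadd⟩, hAmul⟩, hAext⟩ := hA
  obtain ⟨_, _, _, _⟩ := exists_field_of_completeTheory (φ := φ) hAK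
  have : (ringHom φ k).IsExpansionOn A :=
    ⟨fun g y => LHom.map_onFunction φ g y, fun r => nomatch r⟩
  obtain ⟨E, _, ⟨f⟩, hcard⟩ := exists_elementaryEmbedding_mk_lt L A
  have hEK : E ⊨ L.completeTheory K := (f.theory_model_iff _).1 hAK
  obtain ⟨_, _, _, _⟩ := exists_field_of_completeTheory (φ := φ) hEK
  obtain ⟨g, hg⟩ := map_ring_of_elementaryEmbedding (φ := φ) f
  let : Algebra A E := g.toAlgebra
  obtain ⟨t, ht⟩ := exists_transcendental_of_mk_lt hcard
  have hex (i : Fin k) := exists_derivation_extension ht (f (c i)) (derMap L i : A → A)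
    ((realize_addAxiom (φ := φ) i).1 (hAadd.realize_of_mem _ ⟨i, rfl⟩))
    ((realize_leibnizAxiom (φ := φ) i).1 (hAmul.realize_of_mem _ ⟨i, rfl⟩))
  choose D hDadd hDmul hDext hDt using hex
  have hDf (i : Fin k) (a : A) : D i (f a) = f (derMap L i a) := by
    simpa only [RingHom.algebraMap_toAlgebra, hg] using hDext i a
  let : (derLanguage k).Structure E := derStructure D
  have : (ringHom φ k).IsExpansionOn E :=
    ⟨fun g y => LHom.map_onFunction φ g y, fun r => nomatch r⟩
  have hE : E ⊨ derTheory φ K η := by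
    simp only [derTheory, Theory.model_union_iff, LHom.onTheory_model]
    refine ⟨⟨⟨hEK, ⟨?_⟩⟩, ⟨?_⟩⟩, ⟨?_⟩⟩
    · rintro _ ⟨i, rfl⟩
      exact (realize_addAxiom (φ := φ) i).2 (hDadd i)
    · rintro _ ⟨i, rfl⟩
      exact (realize_leibnizAxiom (φ := φ) i).2 (hDmul i)
    · rintro _ ⟨i, χ, a, ha, hχ, rfl⟩
      -- The pair defined by `χ` in `E` is the image of the one in `A`, where the axiom holds.
      have hK : K ⊨ (χ.toFormula.iExsUnique (Fin 2) : L.Sentence) := by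
        refine (realize_iExsUnique_toFormula χ).2 ⟨![a, η i a], (hχ _ _).2 ⟨rfl, rfl⟩,
          fun p hp => ?_⟩
        have hp' : p = ![p 0, p 1] := by ext j; fin_cases j <;> rfl
        rw [hp'] at hp ⊢
        rw [((hχ _ _).1 hp).1, ((hχ _ _).1 hp).2]
      obtain ⟨p, hp, -⟩ := (realize_iExsUnique_toFormula χ).1 (hAK.realize_of_mem _ hK)
      have hunique := (realize_iExsUnique_toFormula χ).1 (hEK.realize_of_mem _ hK)
      refine (realize_extAxiom i χ).2 fun y z hyz => ?_
      have hp' : χ.Realize (default : Empty → E) (f ∘ p) := by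
        rw [← Subsingleton.elim (f ∘ default) (default : Empty → E)]
        exact (f.map_boundedFormula χ default p).2 hp
      have hpair := hunique.unique hyz hp'
      have hy : y = f (p 0) := congrFun hpair 0
      have hz : z = f (p 1) := congrFun hpair 1
      have hA' := (realize_extAxiom i χ).1
        (hAext.realize_of_mem _ ⟨i, χ, a, ha, hχ, rfl⟩) (p 0) (p 1)
        (by convert hp using 1; ext j; fin_cases j <;> rfl)
      rw [hy, hz, ← hA']
      exact hDf i (p 0)
  refine ⟨Theory.ModelType.of _ E, ⟨⟨f, f.injective⟩, ?_, ?_⟩, t, fun i => hDt i⟩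
  · rintro n (g | g) y
    · exact f.map_fun g y
    · obtain ⟨i⟩ := g
      exact (congrArg f (congrArg (Structure.funMap _) (by ext j; fin_cases j; rfl))).trans
        (hDf i (y 0)).symm
  · rintro n (r | r) y
    · exact f.map_rel r y
    · exact nomatch r

/-- In a model of the model completion the derivations take all tuples of values: a solution
exists in an extension, and completeness of the diagram brings it back. -/
lemma exists_derMap_eq_of_isModelCompletion {K : Type w} [Field K] [CharZero K]
    [Ring.CompatibleRing K] [L.Structure K] [φ.IsExpansionOn K] {k : ℕ} {η : Fin k → K → K}
    {Tg : (withDer L k).Theory} (hTg : IsModelCompletion (derTheory φ K η) Tg) {M : Type x}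
    [Nonempty M] [(withDer L k).Structure M] (hM : M ⊨ Tg) (c : Fin k → M) :
    ∃ b, ∀ i, derMap L i b = c i := by
  have hmodels : Tg ⊨ᵇ commonPreimage L k := by
    rw [Theory.models_formula_iff]
    intro N c
    have hN : N ⊨ derTheory φ K η :=
      ⟨fun σ hσ => (hTg.extends_theory σ hσ).realize_sentence N⟩
    let N' : Theory.ModelType.{u, v, max u v} (derTheory φ K η) := Theory.ModelType.of _ N
    obtain ⟨A, f, b, hb⟩ := exists_extension_commonPreimage N' c
    obtain ⟨B, ⟨g⟩⟩ := hTg.exists_embedding A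
    have h := hTg.diagram_complete N' N B (Embedding.refl _ N) (g.comp f)
      ((commonPreimage L k).relabel c)
    refine (Formula.realize_relabel (v := (id : N → N))).1 (h.2 (Formula.realize_relabel.2 ?_))
    refine (realize_commonPreimage _).2 ⟨g b, fun i => ?_⟩
    have hgb := g.map_fun (derSymb L i) ![b]
    rw [show g ∘ ![b] = ![g b] by ext j; fin_cases j; rfl] at hgb
    exact hgb.symm.trans (congrArg g (hb i))
  exact (realize_commonPreimage c).1 (hmodels.realize_formula M)

end Extension

/-! ### Fields of constants -/

section Constants

variable {M : Type x} [Field M]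

/-- The field of constants of a derivation `d` of `M`. -/
def constants (d : Derivation ℤ M M) : Subfield M where
  carrier := {a | d a = 0}
  mul_mem' {a b} ha hb := by simp_all
  one_mem' := by simp
  add_mem' {a b} ha hb := by simp_all
  zero_mem' := by simp
  neg_mem' {a} ha := by simp_all
  inv_mem' a ha := by simp_all [Derivation.leibniz_inv]

lemma mem_constants {d : Derivation ℤ M M} {a : M} : a ∈ constants d ↔ d a = 0 := Iff.rfl

/-- An element `b` algebraic over the constants is a root of a separable polynomial `p` with
constant coefficients, and `0 = d (p b) = p' b * d b` forces `d b = 0`. -/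
lemma not_finiteDimensional_constants [CharZero M] {d : Derivation ℤ M M} {b : M} (hb : d b ≠ 0) :
    ¬ FiniteDimensional (constants d) M := by
  intro _
  let d' : Derivation (constants d) M M :=
    { d with
      map_smul' := fun c a => by
        have hc : d (c : M) = 0 := c.2
        simp [Subfield.smul_def, hc]
      map_one_eq_zero' := d.map_one_eq_zero
      leibniz' := d.leibniz }
  have hint : IsIntegral (constants d) b := .of_finite _ b
  have h := d'.map_aeval (minpoly (constants d) b) b
  rw [minpoly.aeval, map_zero, smul_eq_mul] at h
  rcases mul_eq_zero.1 h.symm with h | h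
  · exact (minpoly.irreducible hint).separable.aeval_derivative_ne_zero (minpoly.aeval _ b) h
  · exact hb h

end Constants

end GenericDer

open GenericDer in
theorem mainTheorem11
    {L : FirstOrder.Language.{u, v}} (φ : FirstOrder.Language.ring.LHom L)
    {K : Type w} [Field K] [CharZero K] [FirstOrder.Ring.CompatibleRing K]
    [L.Structure K] [φ.IsExpansionOn K]
    (hK : GenericDer.AlgebraicallyBounded φ K)
    {k : ℕ} (hk : 2 ≤ k)
    (η : Fin k → K → K)
    (hη : ∀ i, GenericDer.IsDerivationOn (GenericDer.dcl L (∅ : Set K)) (η i))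
    (Tg : (GenericDer.withDer L k).Theory)
    (hTg : GenericDer.IsModelCompletion (GenericDer.derTheory φ K η) Tg)
    {M : Type x} [Field M] [FirstOrder.Ring.CompatibleRing M]
    [(GenericDer.withDer L k).Structure M] [(GenericDer.ringHom φ k).IsExpansionOn M]
    (hM : Tg.Model M) :
    (∃ C : Fin k → Subfield M,
      (∀ i, (C i : Set M) = {a | GenericDer.derMap L i a = 0}) ∧
      (∀ i, (∅ : Set M).Definable₁ (GenericDer.withDer L k) (C i : Set M)) ∧
      (∀ i, ¬ FiniteDimensional (C i) M) ∧
      (∀ i j, i ≠ j → ∀ a : M, ∃ b ∈ C i, ∃ c ∈ C j, a = b + c)) ∧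
    ¬ ∃ dim : ∀ n : ℕ, Set (Fin n → M) → WithBot ℕ,
      GenericDer.IsDimensionFunction (GenericDer.withDer L k) M dim := by
  have hMT : M ⊨ derTheory φ K η :=
    ⟨fun σ hσ => (hTg.extends_theory σ hσ).realize_sentence M⟩
  let : L.Structure M := (LHom.sumInl : L →ᴸ withDer L k).reduct M
  have : φ.IsExpansionOn M :=
    ⟨fun g y => (ringHom φ k).map_onFunction g y, fun r => nomatch r⟩
  have hMT' := hMT
  simp only [derTheory, Theory.model_union_iff, LHom.onTheory_model] at hMT'
  obtain ⟨⟨⟨hMK, hadd⟩, hmul⟩, -⟩ := hMT'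
  have := charZero_of_completeTheory (φ := φ) hMK
  have hadd' (i : Fin k) := (realize_addAxiom (φ := φ) i).1 (hadd.realize_of_mem _ ⟨i, rfl⟩)
  have hmul' (i : Fin k) := (realize_leibnizAxiom (φ := φ) i).1 (hmul.realize_of_mem _ ⟨i, rfl⟩)
  let d (i : Fin k) : Derivation ℤ M M :=
    .mk' (AddMonoidHom.mk' (derMap L i) (hadd' i)).toIntLinearMap (hmul' i)
  have hd (i : Fin k) (a : M) : d i a = derMap L i a := rfl
  have hval := exists_derMap_eq_of_isModelCompletion hTg hM
  obtain ⟨b, hb⟩ := hval fun _ => 1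
  have hb' (i : Fin k) : d i b ≠ 0 := by simp [hd, hb]
  have hdef (i : Fin k) : (∅ : Set M).Definable₁ (withDer L k) (constants (d i) : Set M) := by
    have hder : (∅ : Set M).DefinableFun (withDer L k) fun v : Fin 1 → M => derMap L i (v 0) := by
      simpa [derMap] using
        ((derSymb L i).apply₁ (Term.var (0 : Fin 1))).definableFun_realize (M := M)
    -- As a difference of equal values, the constant `0` needs no parameter.
    have hzero : (∅ : Set M).DefinableFun (withDer L k) fun _ : Fin 1 → M => (0 : M) := by
      simpa using hder.sub (ringHom φ k) hder
    exact hder.ofPred_eq hzero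
  have hsum (i j : Fin k) (hij : i ≠ j) (a : M) :
      ∃ b ∈ constants (d i), ∃ c ∈ constants (d j), a = b + c := by
    obtain ⟨y, hy⟩ := hval fun l => if l = j then derMap L j a else 0
    refine ⟨y, ?_, a - y, ?_, by ring⟩
    · simp [mem_constants, hd, hy, hij]
    · rw [mem_constants, map_sub, hd, hd, hy]
      simp
  refine ⟨⟨fun i => constants (d i), fun i => rfl, hdef,
    fun i => not_finiteDimensional_constants (hb' i), hsum⟩, ?_⟩
  rintro ⟨dim, hdim⟩
  have hdef' (i : Fin k) := (hdef i).mono (Set.subset_univ ∅)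
  have hzero (i : Fin k) := hdim.dim_subfield_eq_zero (ringHom φ k) (hdef' i) (hb' i)
  let i : Fin k := ⟨0, by omega⟩
  let j : Fin k := ⟨1, by omega⟩
  exact hdim.false_of_dim_eq_zero (ringHom φ k) (hdef' i) (hdef' j) (hzero i) (hzero j)
    (hsum i j (by simp [i, j]))
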